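/- Let $G$ be a finite group. For $x,y\in G$ put $[x,y]=x^{-1}y^{-1}xy$, let $K(G)=\{[x,y] : x,y\in G\}$ be the set of commutators, and let $G'$ be the commutator subgroup of $G$. For $g\in G$ put $$\mathrm{Pr}_g(G)=\frac{|\{(x,y)\in G\times G : [x,y]=g\}|}{|G|^2},\qquad P(G)=\{\mathrm{Pr}_g(G) : 1\neq g\in K(G)\}.$$ For an integer $m>1$, say that $G$ is of conjugate type $(1,m)$ if every non-central element of $G$ has exactly $m$ conjugates in $G$. Let $p$ be a prime, $n\geq 1$ an integer, and $G$ a finite $p$-group of nilpotency class $3$ and conjugate type $(1,p^{2n})$. Then for every $g\in G'$, $$\mathrm{Pr}_g(G)=\begin{cases}\dfrac{p^{3n}+p^{2n}-1}{p^{5n}}, & \text{if } g=1,\\[2ex] \dfrac{p^{2n}-1}{p^{5n}}, & \text{if } g\neq 1.\end{cases}$$ Hence $|P(G)|=1$. -/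

import Mathlib

/-- The commutator `[x, y] = x⁻¹ y⁻¹ x y` (Mathlib's `⁅x, y⁆` is `x y x⁻¹ y⁻¹` instead). -/
def groupComm {G : Type*} [Group G] (x y : G) : G := x⁻¹ * y⁻¹ * x * y

/-- The fiber of `g` under the commutator word map: all pairs `(x, y)` with `[x, y] = g`. -/
def commFiber {G : Type*} [Group G] (g : G) : Set (G × G) := {q | groupComm q.1 q.2 = g}

/-- The set `K(G)` of all commutators of `G` (a subset, not the subgroup it generates). -/
def commSet (G : Type*) [Group G] : Set G := {g | ∃ x y : G, groupComm x y = g}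

/-- `Pr_g(G)`, the proportion of pairs `(x, y)` in `G × G` with `[x, y] = g`. -/
noncomputable def commPr {G : Type*} [Group G] (g : G) : ℚ :=
  (Nat.card (commFiber g) : ℚ) / (Nat.card G : ℚ) ^ 2

/-- `P(G) = {Pr_g(G) | 1 ≠ g ∈ K(G)}`. -/
def commPrSet (G : Type*) [Group G] : Set ℚ := {r | ∃ g ∈ commSet G, g ≠ 1 ∧ commPr g = r}

/-- `G` is of conjugate type `(1, m)`: `m > 1` and every non-central element of `G` has exactly
`m` conjugates. -/
def IsConjugateType (G : Type*) [Group G] (m : ℕ) : Prop :=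
  1 < m ∧ ∀ g : G, g ∉ Subgroup.center G → Nat.card (conjugatesOf g) = m

/-!
Write `Z` and `Z₂` for the centre and the second centre, `C x` for the centralizer of `x` modulo
`Z`, and `m` for the common size of the non-central conjugacy classes. If `c = ⁅x, y⁆` is not
central, the Jacobi identity and counting conjugates of `c` and `y` show that the centralizer of `c`
is exactly `Z₂`, that `G = C x * C y`, and that `C x` and `C y` meet in `Z₂`. Comparing the indices
of `C x`, `C y` and `C (x * y)` makes `m = q ^ 2` a square, and then `Z` has index `q ^ 3` and `Z₂`
has index `q ^ 2`.

Fix `g ≠ 1` in `G'` and let `T` be the set of all `x` such that `⁅x, y⁆ = g` is solvable. The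
pairs `(x, y)` solving the equation number `|T| |G| / q ^ 2`, so everything reduces to
`|T ∪ Z| = q ^ 2 |Z|`. If `g` is central then `T ∪ Z` is some `C t` with `t ∉ Z₂`; otherwise
`T ∪ Z` meets every coset of `Z₂` in exactly one coset of `Z`.
-/

open Subgroup
open scoped commutatorElement

section Commutators

variable {G : Type*} [Group G]

theorem groupComm_eq_commutatorElement_inv (x y : G) : groupComm x y = ⁅x⁻¹, y⁻¹⁆ := by
  simp [groupComm, commutatorElement_def]

theorem groupComm_mem_commutator (x y : G) : groupComm x y ∈ commutator G := by
  rw [groupComm_eq_commutatorElement_inv]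
  exact Subgroup.commutator_mem_commutator (mem_top _) (mem_top _)

theorem mem_centralizer_singleton_iff_commutatorElement {x z : G} :
    z ∈ centralizer {x} ↔ ⁅x, z⁆ = 1 := by
  rw [mem_centralizer_singleton_iff, commutatorElement_eq_one_iff_mul_comm, eq_comm]

theorem commutatorElement_eq_iff_inv_mul_mem_centralizer {x y z : G} :
    ⁅x, y⁆ = ⁅x, z⁆ ↔ y⁻¹ * z ∈ centralizer {x} := by
  have hconj : ⁅x, y⁻¹ * z⁆ = y⁻¹ * (⁅x, y⁆⁻¹ * ⁅x, z⁆) * y := by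
    simp only [commutatorElement_def]
    group
  rw [mem_centralizer_singleton_iff_commutatorElement, hconj, mul_eq_one_iff_eq_inv, mul_eq_left,
    inv_mul_eq_one]

theorem commutatorElement_mem_center_comm {x y : G} : ⁅x, y⁆ ∈ center G ↔ ⁅y, x⁆ ∈ center G := by
  rw [← commutatorElement_inv, inv_mem_iff]

theorem commutatorElement_mul_right_of_mem_center {x z : G} (y : G) (h : ⁅x, z⁆ ∈ center G) :
    ⁅x, y * z⁆ = ⁅x, y⁆ * ⁅x, z⁆ := by
  rw [commutatorElement_mul_right_eq_mul_conj, mul_assoc ⁅x, y⁆, mem_center_iff.1 h y,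
    ← mul_assoc, mul_inv_cancel_right]

theorem commutatorElement_mul_left_of_mem_center {y z : G} (x : G) (h : ⁅z, y⁆ ∈ center G) :
    ⁅x * z, y⁆ = ⁅x, y⁆ * ⁅z, y⁆ := by
  rw [commutatorElement_mul_left_eq_conj_mul, mem_center_iff.1 h x, mul_inv_cancel_right,
    mem_center_iff.1 h]

theorem commutatorElement_inv_right_of_mem_center {x y : G} (h : ⁅x, y⁆ ∈ center G) :
    ⁅x, y⁻¹⁆ = ⁅x, y⁆⁻¹ := by
  refine eq_inv_of_mul_eq_one_left ?_
  rw [← commutatorElement_mul_right_of_mem_center _ h, inv_mul_cancel, commutatorElement_one_right]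

theorem commutatorElement_inv_left_of_mem_center {x y : G} (h : ⁅x, y⁆ ∈ center G) :
    ⁅x⁻¹, y⁆ = ⁅x, y⁆⁻¹ := by
  rw [← commutatorElement_inv, commutatorElement_inv_right_of_mem_center
    (commutatorElement_mem_center_comm.1 h), commutatorElement_inv]

theorem commutatorElement_eq_one_of_mem_center_right {k : G} (hk : k ∈ center G) (x : G) :
    ⁅x, k⁆ = 1 := commutatorElement_eq_one_iff_mul_comm.2 (mem_center_iff.1 hk x)

theorem commutatorElement_eq_one_of_mem_center_left {k : G} (hk : k ∈ center G) (x : G) :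
    ⁅k, x⁆ = 1 := commutatorElement_eq_one_iff_mul_comm.2 (mem_center_iff.1 hk x).symm

theorem commutatorElement_mul_center_left {k : G} (hk : k ∈ center G) (x y : G) :
    ⁅x * k, y⁆ = ⁅x, y⁆ := by
  have h := commutatorElement_eq_one_of_mem_center_left hk y
  rw [commutatorElement_mul_left_of_mem_center x (h ▸ one_mem _), h, mul_one]

theorem commutatorElement_mul_center_right {k : G} (hk : k ∈ center G) (x y : G) :
    ⁅x, y * k⁆ = ⁅x, y⁆ := by
  have h := commutatorElement_eq_one_of_mem_center_right hk x
  rw [commutatorElement_mul_right_of_mem_center y (h ▸ one_mem _), h, mul_one]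

end Commutators

section SecondCenter

variable {G : Type*} [Group G]

variable (G) in
/-- The second centre `Z₂(G)`, as a term of the upper central series. -/
abbrev secondCenter : Subgroup G := Subgroup.upperCentralSeries G 2

theorem mem_secondCenter {z : G} : z ∈ secondCenter G ↔ ∀ x, ⁅z, x⁆ ∈ center G := by
  rw [secondCenter, Subgroup.mem_upperCentralSeries_succ_iff, Subgroup.upperCentralSeries_one]

theorem comap_center_quotient_center :
    (center (G ⧸ center G)).comap (QuotientGroup.mk' (center G)) = secondCenter G := by
  rw [← Subgroup.upperCentralSeries_one (G ⧸ center G),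
    Subgroup.comap_upperCentralSeries_quotient_center]

theorem center_le_secondCenter : center G ≤ secondCenter G := fun _ hz =>
  mem_secondCenter.2 fun x => commutatorElement_eq_one_of_mem_center_left hz x ▸ one_mem _

theorem notMem_secondCenter_left {x y : G} (hxy : ⁅x, y⁆ ∉ center G) : x ∉ secondCenter G :=
  fun hx => hxy (mem_secondCenter.1 hx y)

theorem notMem_secondCenter_right {x y : G} (hxy : ⁅x, y⁆ ∉ center G) : y ∉ secondCenter G :=
  notMem_secondCenter_left fun h => hxy (commutatorElement_mem_center_comm.1 h)

theorem exists_commutatorElement_notMem_center {x : G} (hx : x ∉ secondCenter G) :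
    ∃ y, ⁅x, y⁆ ∉ center G := by
  by_contra! h
  exact hx (mem_secondCenter.2 h)

theorem exists_commutatorElement_notMem_center_of_ne_top (hne : secondCenter G ≠ ⊤) :
    ∃ x y : G, ⁅x, y⁆ ∉ center G := by
  by_contra! h
  exact hne (eq_top_iff.2 fun x _ => mem_secondCenter.2 (h x))

theorem commutatorElement_mul_secondCenter_left {z : G} (hz : z ∈ secondCenter G) (x y : G) :
    ⁅x * z, y⁆ = ⁅x, y⁆ * ⁅z, y⁆ :=
  commutatorElement_mul_left_of_mem_center x (mem_secondCenter.1 hz y)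

theorem secondCenter_mul_commutatorElement {a : G} (ha : a ∈ secondCenter G) (x y : G) :
    a * ⁅x, y⁆ = ⁅x, y⁆ * a := by
  have hconj (x : G) : a * x * a⁻¹ = x * ⁅a, x⁆ := by
    rw [mem_center_iff.1 (mem_secondCenter.1 ha x), commutatorElement_def, inv_mul_cancel_right]
  rw [← mul_inv_eq_iff_eq_mul, conjugate_commutatorElement, hconj, hconj,
    commutatorElement_mul_center_left (mem_secondCenter.1 ha x),
    commutatorElement_mul_center_right (mem_secondCenter.1 ha y)]

theorem commutator_le_centralizer {a : G} (ha : a ∈ secondCenter G) :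
    commutator G ≤ centralizer {a} :=
  Subgroup.commutator_le.2 fun x _ y _ =>
    mem_centralizer_singleton_iff.2 (secondCenter_mul_commutatorElement ha x y).symm

/-- Conjugation by `x` multiplies `y` and `v` by `⁅x, y⁆` and `⁅x, v⁆`, which lie in the second
centre; expanding the conjugate of `⁅y, v⁆` gives the Jacobi identity. -/
theorem commutatorElement_jacobi (hclass : ∀ x y : G, ⁅x, y⁆ ∈ secondCenter G) (x y v : G) :
    ⁅x, ⁅y, v⁆⁆ = ⁅⁅x, y⁆, v⁆ * ⁅y, ⁅x, v⁆⁆ := by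
  set a := ⁅x, y⁆ with ha
  set b := ⁅x, v⁆ with hb
  have hab : ⁅a, b⁆ = 1 := commutatorElement_eq_one_iff_mul_comm.2
    (secondCenter_mul_commutatorElement (hclass x y) x v)
  have hleft : ⁅a, b * v⁆ = ⁅a, v⁆ := by
    rw [commutatorElement_mul_right_of_mem_center b (mem_secondCenter.1 (hclass x y) v), hab,
      one_mul]
  have hright : ⁅y, b * v⁆ = ⁅y, b⁆ * ⁅y, v⁆ := by
    rw [commutatorElement_mul_right_eq_mul_conj, mul_assoc ⁅y, b⁆, mul_assoc ⁅y, b⁆,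
      secondCenter_mul_commutatorElement (hclass x v), mul_inv_cancel_right]
  have hconj : x * ⁅y, v⁆ * x⁻¹ = ⁅a, v⁆ * ⁅y, b⁆ * ⁅y, v⁆ :=
    calc x * ⁅y, v⁆ * x⁻¹ = ⁅a * y, b * v⁆ := by
          rw [conjugate_commutatorElement, ha, hb, commutatorElement_def x y,
            commutatorElement_def x v, inv_mul_cancel_right, inv_mul_cancel_right]
      _ = ⁅y, b * v⁆ * ⁅a, b * v⁆ := by
          rw [commutatorElement_mul_left_eq_conj_mul, secondCenter_mul_commutatorElement
            (hclass x y), mul_inv_cancel_right]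
      _ = ⁅a, v⁆ * ⁅y, b⁆ * ⁅y, v⁆ := by
          rw [hleft, hright, mem_center_iff.1 (mem_secondCenter.1 (hclass x y) v), mul_assoc]
  rw [commutatorElement_def, hconj, mul_inv_cancel_right]

end SecondCenter

section CentralCommutators

variable {G : Type*} [Group G]

/-- The centralizer of `x` modulo the centre, i.e. the preimage in `G` of the centralizer of the
image of `x` in `G ⧸ Z(G)`. -/
def centralizerMod (x : G) : Subgroup G :=
  (centralizer {QuotientGroup.mk' (center G) x}).comap (QuotientGroup.mk' (center G))

theorem mem_centralizerMod {x z : G} : z ∈ centralizerMod x ↔ ⁅x, z⁆ ∈ center G := by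
  rw [centralizerMod, mem_comap, mem_centralizer_singleton_iff_commutatorElement,
    ← map_commutatorElement, QuotientGroup.mk'_apply, QuotientGroup.eq_one_iff]

theorem mem_centralizerMod_comm {x z : G} : z ∈ centralizerMod x ↔ x ∈ centralizerMod z := by
  rw [mem_centralizerMod, mem_centralizerMod, commutatorElement_mem_center_comm]

theorem mem_centralizerMod_self (x : G) : x ∈ centralizerMod x := by
  rw [mem_centralizerMod, commutatorElement_self]
  exact one_mem _

theorem secondCenter_le_centralizerMod (x : G) : secondCenter G ≤ centralizerMod x :=
  fun _ hz => mem_centralizerMod.2 (commutatorElement_mem_center_comm.1 (mem_secondCenter.1 hz x))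

theorem centralizer_le_centralizerMod (x : G) : centralizer {x} ≤ centralizerMod x := fun z hz => by
  rw [mem_centralizerMod, mem_centralizer_singleton_iff_commutatorElement.1 hz]
  exact one_mem _

theorem centralizerMod_eq_top {c : G} (hc : c ∈ secondCenter G) : centralizerMod c = ⊤ :=
  eq_top_iff.2 fun x _ => mem_centralizerMod.2 (mem_secondCenter.1 hc x)

theorem normal_centralizerMod (hclass : ∀ x y : G, ⁅x, y⁆ ∈ secondCenter G) (x : G) :
    (centralizerMod x).Normal := by
  refine ⟨fun z hz g => ?_⟩
  rw [← inv_mul_cancel_right (g * z * g⁻¹) z]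
  exact mul_mem (secondCenter_le_centralizerMod x (hclass g z)) hz

/-- The homomorphism `z ↦ ⁅x, z⁆` on the centralizer of `x` modulo the centre. -/
def commutatorHom (x : G) : centralizerMod x →* G where
  toFun z := ⁅x, (z : G)⁆
  map_one' := commutatorElement_one_right x
  map_mul' _ z := commutatorElement_mul_right_of_mem_center _ (mem_centralizerMod.1 z.2)

/-- The subgroup of those elements of the centre that are commutators `⁅x, z⁆` with `z ∈ K`. -/
def centralCommutators (x : G) (K : Subgroup G) : Subgroup G :=
  (K.subgroupOf (centralizerMod x)).map (commutatorHom x)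

theorem mem_centralCommutators {x g : G} {K : Subgroup G} :
    g ∈ centralCommutators x K ↔ ∃ z ∈ K, z ∈ centralizerMod x ∧ ⁅x, z⁆ = g := by
  constructor
  · rintro ⟨⟨z, hz⟩, hzK, rfl⟩
    exact ⟨z, hzK, hz, rfl⟩
  · rintro ⟨z, hzK, hz, rfl⟩
    exact ⟨⟨z, hz⟩, hzK, rfl⟩

theorem commutatorElement_mem_centralCommutators {x z : G} (hz : z ∈ centralizerMod x) :
    ⁅x, z⁆ ∈ centralCommutators x ⊤ :=
  mem_centralCommutators.2 ⟨z, mem_top z, hz, rfl⟩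

theorem centralCommutators_mono (x : G) {K L : Subgroup G} (h : K ≤ L) :
    centralCommutators x K ≤ centralCommutators x L :=
  map_mono fun _ hz => h hz

theorem centralCommutators_le_center (x : G) (K : Subgroup G) :
    centralCommutators x K ≤ center G := by
  intro g hg
  obtain ⟨z, -, hz, rfl⟩ := mem_centralCommutators.1 hg
  exact mem_centralizerMod.1 hz

theorem centralCommutators_inv (x : G) (K : Subgroup G) :
    centralCommutators x⁻¹ K = centralCommutators x K := by
  have hle (x : G) : centralCommutators x K ≤ centralCommutators x⁻¹ K := by
    intro g hg
    obtain ⟨z, hzK, hz, rfl⟩ := mem_centralCommutators.1 hg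
    have hinv : ⁅x⁻¹, z⁻¹⁆ = ⁅x, z⁆ := by
      have h := commutatorElement_inv_left_of_mem_center (mem_centralizerMod.1 hz)
      rw [commutatorElement_inv_right_of_mem_center
        (h ▸ inv_mem (mem_centralizerMod.1 hz)), h, inv_inv]
    exact mem_centralCommutators.2 ⟨z⁻¹, inv_mem hzK,
      mem_centralizerMod.2 (hinv ▸ mem_centralizerMod.1 hz), hinv⟩
  exact le_antisymm (by simpa only [inv_inv] using hle x⁻¹) (hle x)

theorem centralCommutators_mul_center {k : G} (hk : k ∈ center G) (x : G) (K : Subgroup G) :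
    centralCommutators (x * k) K = centralCommutators x K := by
  ext g
  simp only [mem_centralCommutators, mem_centralizerMod, commutatorElement_mul_center_left hk]

theorem card_centralCommutators_mul_index (x : G) (K : Subgroup G) :
    Nat.card (centralCommutators x K) * (K ⊓ centralizerMod x).index =
      (K ⊓ centralizer {x}).index := by
  have hker : (commutatorHom x).ker = (centralizer {x}).subgroupOf (centralizerMod x) := by
    ext z
    exact mem_centralizer_singleton_iff_commutatorElement.symm
  have hinf : centralizer {x} ⊓ (K ⊓ centralizerMod x) = K ⊓ centralizer {x} := by
    rw [inf_left_comm, inf_eq_left.2 (centralizer_le_centralizerMod x)]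
  rw [centralCommutators, ← relIndex_ker, hker, ← inf_subgroupOf_right K,
    relIndex_subgroupOf inf_le_right, ← inf_relIndex_right, relIndex_mul_index inf_le_right, hinf]

end CentralCommutators

theorem index_centralizer_singleton {G : Type*} [Group G] (x : G) :
    (centralizer {x}).index = Nat.card (conjugatesOf x) := by
  have horbit : MulAction.orbit (ConjAct G) x = conjugatesOf x := by
    ext y
    rw [ConjAct.mem_orbit_conjAct, isConj_comm]
    rfl
  rw [Nat.card_coe_set_eq, ← horbit, ← MulAction.index_stabilizer,
    ConjAct.stabilizer_eq_centralizer]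
  rfl

theorem mem_secondCenter_of_centralizerMod_le {G : Type*} [Group G] {x y z : G}
    (hmul : ∀ v, ∃ a ∈ centralizerMod x, ∃ b ∈ centralizerMod y, a * b = v)
    (hx : centralizerMod x ≤ centralizerMod z) (hy : centralizerMod y ≤ centralizerMod z) :
    z ∈ secondCenter G := by
  refine mem_secondCenter.2 fun v => mem_centralizerMod.1 ?_
  obtain ⟨a, ha, b, hb, rfl⟩ := hmul v
  exact mul_mem (hx ha) (hy hb)

theorem commutatorElement_commutatorElement_eq {G : Type*} [Group G]
    (hclass : ∀ x y : G, ⁅x, y⁆ ∈ secondCenter G) {y z : G} (x : G) (hz : z ∈ centralizerMod y) :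
    ⁅⁅x, y⁆, z⁆ = ⁅y, ⁅x, z⁆⁻¹⁆ := by
  have h := commutatorElement_jacobi hclass x y z
  rw [commutatorElement_eq_one_of_mem_center_right (mem_centralizerMod.1 hz)] at h
  rw [commutatorElement_inv_right_of_mem_center
    (mem_centralizerMod.1 (secondCenter_le_centralizerMod y (hclass x z)))]
  exact eq_inv_of_mul_eq_one_left h.symm

theorem centralCommutators_commutatorElement_le {G : Type*} [Group G]
    (hclass : ∀ x y : G, ⁅x, y⁆ ∈ secondCenter G) (x y : G) :
    centralCommutators ⁅x, y⁆ (centralizerMod y) ≤ centralCommutators y (commutator G) := by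
  intro g hg
  obtain ⟨z, hz, -, rfl⟩ := mem_centralCommutators.1 hg
  exact mem_centralCommutators.2 ⟨⁅x, z⁆⁻¹,
    inv_mem (commutator_mem_commutator (mem_top x) (mem_top z)),
    inv_mem (secondCenter_le_centralizerMod y (hclass x z)),
    (commutatorElement_commutatorElement_eq hclass x hz).symm⟩

namespace IsConjugateType

section Centralizers

variable {G : Type*} [Group G] {m : ℕ}

theorem index_centralizer (htype : IsConjugateType G m) {x : G} (hx : x ∉ center G) :
    (centralizer {x}).index = m := by
  rw [index_centralizer_singleton, htype.2 x hx]

theorem card_centralCommutators_top_mul_index (htype : IsConjugateType G m) {x : G}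
    (hx : x ∉ center G) :
    Nat.card (centralCommutators x ⊤) * (centralizerMod x).index = m := by
  have h := card_centralCommutators_mul_index x ⊤
  rwa [top_inf_eq, top_inf_eq, htype.index_centralizer hx] at h

variable [Finite G] (htype : IsConjugateType G m) (hclass : ∀ x y : G, ⁅x, y⁆ ∈ secondCenter G)
include htype hclass

/-- By the Jacobi identity, `⁅⁅x, y⁆, z⁆` for `z` in `centralizerMod y` is a commutator of `y`
with an element of the second centre. As `⁅x, y⁆` and `y` have equally many conjugates, there are
enough of these only if every element commuting with `⁅x, y⁆` lies in `centralizerMod y`. -/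
theorem centralizer_commutatorElement_le {x y : G} (hxy : ⁅x, y⁆ ∉ center G) :
    centralizer {⁅x, y⁆} ≤ centralizerMod y := by
  set c := ⁅x, y⁆
  have hy : y ∉ center G := fun h => notMem_secondCenter_right hxy (center_le_secondCenter h)
  have hle : Nat.card (centralCommutators c (centralizerMod y)) ≤
      Nat.card (centralCommutators y ⊤) :=
    card_le_of_le ((centralCommutators_commutatorElement_le hclass x y).trans
      (centralCommutators_mono y le_top))
  have hindex : (centralizerMod y ⊓ centralizer {c}).index ≤ (centralizer {c}).index := by
    rw [← card_centralCommutators_mul_index, centralizerMod_eq_top (hclass x y), inf_top_eq,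
      htype.index_centralizer hxy, ← htype.card_centralCommutators_top_mul_index hy]
    exact Nat.mul_le_mul_right _ hle
  by_contra hnot
  exact hindex.not_gt (index_strictAnti (inf_lt_right.2 hnot))

theorem centralCommutators_commutatorElement_right {x y : G} (hxy : ⁅x, y⁆ ∉ center G) :
    centralCommutators ⁅x, y⁆ (centralizerMod y) = centralCommutators y ⊤ := by
  have hy : y ∉ center G := fun h => notMem_secondCenter_right hxy (center_le_secondCenter h)
  have hcard := card_centralCommutators_mul_index ⁅x, y⁆ (centralizerMod y)
  rw [centralizerMod_eq_top (hclass x y), inf_top_eq,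
    inf_eq_right.2 (htype.centralizer_commutatorElement_le hclass hxy),
    htype.index_centralizer hxy, ← htype.card_centralCommutators_top_mul_index hy] at hcard
  exact eq_of_le_of_card_ge ((centralCommutators_commutatorElement_le hclass x y).trans
    (centralCommutators_mono y le_top))
    (Nat.eq_of_mul_eq_mul_right (Nat.pos_of_ne_zero index_ne_zero_of_finite) hcard).ge

theorem centralCommutators_commutatorElement_left {x y : G} (hxy : ⁅x, y⁆ ∉ center G) :
    centralCommutators ⁅x, y⁆ (centralizerMod x) = centralCommutators x ⊤ := by
  rw [← commutatorElement_inv, centralCommutators_inv]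
  exact htype.centralCommutators_commutatorElement_right hclass
    fun h => hxy (commutatorElement_mem_center_comm.1 h)

theorem centralCommutators_top_eq_commutator {x : G} (hx : x ∉ secondCenter G) :
    centralCommutators x ⊤ = centralCommutators x (commutator G) := by
  obtain ⟨y, hxy⟩ := exists_commutatorElement_notMem_center hx
  refine le_antisymm ?_ (centralCommutators_mono x le_top)
  rw [← htype.centralCommutators_commutatorElement_right hclass
    fun h => hxy (commutatorElement_mem_center_comm.1 h)]
  exact centralCommutators_commutatorElement_le hclass y x

theorem exists_centralizerMod_mul_eq {x y : G} (hxy : ⁅x, y⁆ ∉ center G) (v : G) :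
    ∃ a ∈ centralizerMod x, ∃ b ∈ centralizerMod y, a * b = v := by
  set c := ⁅x, y⁆
  have hmem (u w z : G) : ⁅u, ⁅w, z⁆⁆ ∈ centralCommutators u ⊤ :=
    commutatorElement_mem_centralCommutators (secondCenter_le_centralizerMod u (hclass w z))
  obtain ⟨s, hs, -, hcs⟩ := mem_centralCommutators.1
    ((htype.centralCommutators_commutatorElement_left hclass hxy).ge (hmem x y v))
  obtain ⟨t, ht, -, hct⟩ := mem_centralCommutators.1
    ((htype.centralCommutators_commutatorElement_right hclass hxy).ge (hmem y x v))
  have hst : ⁅c, s⁆ = ⁅c, v * t⁆ := by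
    rw [commutatorElement_mul_right_of_mem_center v (mem_secondCenter.1 (hclass x y) t), hcs, hct,
      commutatorElement_jacobi hclass]
  have hk : s⁻¹ * (v * t) ∈ centralizerMod y :=
    htype.centralizer_commutatorElement_le hclass hxy
      (commutatorElement_eq_iff_inv_mul_mem_centralizer.1 hst)
  exact ⟨s, hs, s⁻¹ * (v * t) * t⁻¹, mul_mem hk (inv_mem ht), by group⟩

theorem centralizerMod_le_of_mem_centralizer_commutatorElement {x y z : G}
    (hxy : ⁅x, y⁆ ∉ center G) (hz : z ∈ centralizer {⁅x, y⁆}) :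
    centralizerMod x ≤ centralizerMod z := by
  intro b hb
  have hxyb : ⁅x, y * b⁆ = ⁅x, y⁆ * ⁅x, b⁆ :=
    commutatorElement_mul_right_of_mem_center y (mem_centralizerMod.1 hb)
  have hcentral : centralizer {⁅x, y * b⁆} = centralizer {⁅x, y⁆} := by
    ext w
    rw [mem_centralizer_singleton_iff_commutatorElement, hxyb,
      commutatorElement_mul_center_left (mem_centralizerMod.1 hb),
      mem_centralizer_singleton_iff_commutatorElement]
  have hy : y ∈ centralizerMod z :=
    mem_centralizerMod_comm.1 (htype.centralizer_commutatorElement_le hclass hxy hz)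
  have hyb : y * b ∈ centralizerMod z :=
    mem_centralizerMod_comm.1 (htype.centralizer_commutatorElement_le hclass
      (hxyb ▸ fun h => hxy ((mul_mem_cancel_right (mem_centralizerMod.1 hb)).1 h))
      (hcentral.symm ▸ hz))
  exact (mul_mem_cancel_left hy).1 hyb

theorem centralizer_commutatorElement_eq_secondCenter {x y : G} (hxy : ⁅x, y⁆ ∉ center G) :
    centralizer {⁅x, y⁆} = secondCenter G := by
  have hyx : ⁅y, x⁆ ∉ center G := fun h => hxy (commutatorElement_mem_center_comm.1 h)
  refine le_antisymm (fun z hz => ?_) fun z hz => mem_centralizer_singleton_iff.2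
    (secondCenter_mul_commutatorElement hz x y)
  have hz' : z ∈ centralizer {⁅y, x⁆} := by
    rw [mem_centralizer_singleton_iff] at hz ⊢
    rw [← commutatorElement_inv]
    exact Commute.inv_right hz
  exact mem_secondCenter_of_centralizerMod_le (htype.exists_centralizerMod_mul_eq hclass hxy)
    (htype.centralizerMod_le_of_mem_centralizer_commutatorElement hclass hxy hz)
    (htype.centralizerMod_le_of_mem_centralizer_commutatorElement hclass hyx hz')

theorem centralizerMod_le_centralizerMod {x z : G} (hx : x ∉ secondCenter G)
    (hz : z ∈ centralizerMod x) : centralizerMod x ≤ centralizerMod z := by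
  intro a ha
  by_contra hza
  rw [mem_centralizerMod] at hza
  have hjacobi := commutatorElement_jacobi hclass x z a
  rw [commutatorElement_eq_one_of_mem_center_left (mem_centralizerMod.1 hz),
    commutatorElement_eq_one_of_mem_center_right (mem_centralizerMod.1 ha), one_mul] at hjacobi
  refine hx ((htype.centralizer_commutatorElement_eq_secondCenter hclass hza).le ?_)
  exact mem_centralizer_singleton_iff.2 (commutatorElement_eq_one_iff_mul_comm.1 hjacobi)

theorem inf_centralizerMod {x y : G} (hxy : ⁅x, y⁆ ∉ center G) :
    centralizerMod x ⊓ centralizerMod y = secondCenter G := by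
  refine le_antisymm ?_
    (le_inf (secondCenter_le_centralizerMod x) (secondCenter_le_centralizerMod y))
  rintro z ⟨hzx, hzy⟩
  exact mem_secondCenter_of_centralizerMod_le (htype.exists_centralizerMod_mul_eq hclass hxy)
    (htype.centralizerMod_le_centralizerMod hclass (notMem_secondCenter_left hxy) hzx)
    (htype.centralizerMod_le_centralizerMod hclass (notMem_secondCenter_right hxy) hzy)

end Centralizers

section Indices

variable {G : Type*} [Group G] [Finite G] {m : ℕ} (htype : IsConjugateType G m)
  (hclass : ∀ x y : G, ⁅x, y⁆ ∈ secondCenter G)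
include htype hclass

theorem index_secondCenter (hne : secondCenter G ≠ ⊤) : (secondCenter G).index = m := by
  obtain ⟨x, y, hxy⟩ := exists_commutatorElement_notMem_center_of_ne_top hne
  rw [← htype.centralizer_commutatorElement_eq_secondCenter hclass hxy,
    htype.index_centralizer hxy]

theorem index_centralizerMod_mul_index {x y : G} (hxy : ⁅x, y⁆ ∉ center G) :
    (centralizerMod x).index * (centralizerMod y).index = m := by
  have hnormal := normal_centralizerMod hclass y
  have hsup : centralizerMod x ⊔ centralizerMod y = ⊤ := by
    refine eq_top_iff.2 fun v _ => ?_
    obtain ⟨a, ha, b, hb, rfl⟩ := htype.exists_centralizerMod_mul_eq hclass hxy v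
    exact mul_mem_sup ha hb
  have hrel : (secondCenter G).relIndex (centralizerMod x) = (centralizerMod y).index := by
    rw [← htype.inf_centralizerMod hclass hxy, inf_relIndex_left, ← relIndex_sup_right, hsup,
      relIndex_top_right]
  rw [← htype.index_secondCenter hclass fun h => notMem_secondCenter_left hxy (h ▸ mem_top x),
    ← relIndex_mul_index (secondCenter_le_centralizerMod x), hrel, mul_comm]

/-- The elements `x`, `y` and `x * y` pairwise do not commute modulo the centre, so the indices of
their centralizers modulo the centre have pairwise product `m`. -/
theorem index_centralizerMod_sq {x : G} (hx : x ∉ secondCenter G) :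
    (centralizerMod x).index ^ 2 = m := by
  obtain ⟨y, hxy⟩ := exists_commutatorElement_notMem_center hx
  have hxw : ⁅x, x * y⁆ ∉ center G := fun h => hxy <| mem_centralizerMod.1 <|
    (mul_mem_cancel_left (mem_centralizerMod_self x)).1 (mem_centralizerMod.2 h)
  have hyw : ⁅y, x * y⁆ ∉ center G := fun h => hxy <| commutatorElement_mem_center_comm.1 <|
    mem_centralizerMod.1 <|
      (mul_mem_cancel_right (mem_centralizerMod_self y)).1 (mem_centralizerMod.2 h)
  have h₁ := htype.index_centralizerMod_mul_index hclass hxy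
  have h₂ := htype.index_centralizerMod_mul_index hclass hxw
  have h₃ := htype.index_centralizerMod_mul_index hclass hyw
  have hpos (z : G) : 0 < (centralizerMod z).index := Nat.pos_of_ne_zero index_ne_zero_of_finite
  have hxy_eq : (centralizerMod x).index = (centralizerMod y).index :=
    Nat.eq_of_mul_eq_mul_right (hpos (x * y)) (h₂.trans h₃.symm)
  rw [sq]
  nth_rw 2 [hxy_eq]
  exact h₁

theorem disjoint_centralCommutators {x y : G} (hxy : ⁅x, y⁆ ∉ center G) :
    Disjoint (centralCommutators x ⊤) (centralCommutators y ⊤) := by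
  rw [← htype.centralCommutators_commutatorElement_left hclass hxy,
    ← htype.centralCommutators_commutatorElement_right hclass hxy, disjoint_def]
  intro g hgx hgy
  obtain ⟨s, hs, -, rfl⟩ := mem_centralCommutators.1 hgx
  obtain ⟨t, ht, -, hst⟩ := mem_centralCommutators.1 hgy
  have hmem : s⁻¹ * t ∈ secondCenter G := by
    rw [← htype.centralizer_commutatorElement_eq_secondCenter hclass hxy]
    exact commutatorElement_eq_iff_inv_mul_mem_centralizer.1 hst.symm
  have hsy : s ∈ centralizerMod y := by
    rw [← inv_mem_iff]
    exact (mul_mem_cancel_right ht).1 (secondCenter_le_centralizerMod y hmem)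
  rw [← mem_centralizer_singleton_iff_commutatorElement,
    htype.centralizer_commutatorElement_eq_secondCenter hclass hxy,
    ← htype.inf_centralizerMod hclass hxy]
  exact ⟨hs, hsy⟩

theorem centralCommutators_mul_secondCenter {x z : G} (hx : x ∉ secondCenter G)
    (hz : z ∈ secondCenter G) : centralCommutators (x * z) ⊤ = centralCommutators x ⊤ := by
  have hxz : x * z ∉ secondCenter G := fun h => hx ((mul_mem_cancel_right hz).1 h)
  rw [htype.centralCommutators_top_eq_commutator hclass hx,
    htype.centralCommutators_top_eq_commutator hclass hxz]
  ext g
  simp only [mem_centralCommutators, mem_centralizerMod]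
  refine exists_congr fun w => and_congr_right fun hw => ?_
  have hzw : ⁅z, w⁆ = 1 :=
    mem_centralizer_singleton_iff_commutatorElement.1 (commutator_le_centralizer hz hw)
  rw [commutatorElement_mul_secondCenter_left hz, hzw, mul_one]

theorem commutatorElement_secondCenter_eq_one (hne : secondCenter G ≠ ⊤) {u z : G}
    (hu : u ∈ secondCenter G) (hz : z ∈ secondCenter G) : ⁅z, u⁆ = 1 := by
  obtain ⟨x, y, hxy⟩ := exists_commutatorElement_notMem_center_of_ne_top hne
  have hmem {x : G} (hx : x ∉ secondCenter G) : ⁅z, u⁆ ∈ centralCommutators x ⊤ := by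
    have hu (y : G) : ⁅y, u⁆ ∈ centralCommutators y ⊤ :=
      commutatorElement_mem_centralCommutators (secondCenter_le_centralizerMod y hu)
    have hxz := hu (x * z)
    rw [htype.centralCommutators_mul_secondCenter hclass hx hz,
      commutatorElement_mul_secondCenter_left hz] at hxz
    exact (mul_mem_cancel_left (hu x)).1 hxz
  exact disjoint_def.1 (htype.disjoint_centralCommutators hclass hxy)
    (hmem (notMem_secondCenter_left hxy)) (hmem (notMem_secondCenter_right hxy))

theorem centralizer_eq_secondCenter (hne : secondCenter G ≠ ⊤) {u : G}
    (hu : u ∈ secondCenter G) (hu' : u ∉ center G) : centralizer {u} = secondCenter G := by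
  have hle : secondCenter G ≤ centralizer {u} := fun z hz =>
    mem_centralizer_singleton_iff_commutatorElement.2
      (htype.commutatorElement_secondCenter_eq_one hclass hne hz hu)
  refine (hle.eq_of_not_lt fun hlt => (index_strictAnti hlt).ne ?_).symm
  rw [htype.index_centralizer hu', htype.index_secondCenter hclass hne]

theorem secondCenter_inf_centralizer {x : G} (hx : x ∉ secondCenter G) :
    secondCenter G ⊓ centralizer {x} = center G := by
  refine le_antisymm (fun u hu => ?_) (le_inf center_le_secondCenter (center_le_centralizer _))
  by_contra hu'
  refine hx ((htype.centralizer_eq_secondCenter hclass (ne_of_mem_of_not_mem' (mem_top x) hx).symm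
    hu.1 hu').le ?_)
  exact mem_centralizer_singleton_iff.2 (mem_centralizer_singleton_iff.1 hu.2).symm

theorem centralCommutators_top_eq_secondCenter {x : G} (hx : x ∉ secondCenter G) :
    centralCommutators x ⊤ = centralCommutators x (secondCenter G) := by
  refine le_antisymm ?_ (centralCommutators_mono x le_top)
  rw [htype.centralCommutators_top_eq_commutator hclass hx]
  exact centralCommutators_mono x (Subgroup.commutator_le.2 fun a _ b _ => hclass a b)

end Indices

section SquareType

variable {G : Type*} [Group G] [Finite G] {q : ℕ} (htype : IsConjugateType G (q ^ 2))
  (hclass : ∀ x y : G, ⁅x, y⁆ ∈ secondCenter G)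
include htype hclass

theorem index_centralizerMod {x : G} (hx : x ∉ secondCenter G) : (centralizerMod x).index = q :=
  Nat.pow_left_injective two_ne_zero (htype.index_centralizerMod_sq hclass hx)

theorem card_centralCommutators_top {x : G} (hx : x ∉ secondCenter G) :
    Nat.card (centralCommutators x ⊤) = q := by
  have h := htype.card_centralCommutators_top_mul_index fun h => hx (center_le_secondCenter h)
  have hpos : 0 < (centralizerMod x).index := Nat.pos_of_ne_zero index_ne_zero_of_finite
  rw [htype.index_centralizerMod hclass hx] at h hpos
  rw [sq] at h
  exact Nat.eq_of_mul_eq_mul_right hpos h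

theorem index_center (hne : secondCenter G ≠ ⊤) : (center G).index = q ^ 3 := by
  obtain ⟨x, y, hxy⟩ := exists_commutatorElement_notMem_center_of_ne_top hne
  have hx := notMem_secondCenter_left hxy
  have h := card_centralCommutators_mul_index x (secondCenter G)
  rw [← htype.centralCommutators_top_eq_secondCenter hclass hx,
    htype.card_centralCommutators_top hclass hx,
    inf_eq_left.2 (secondCenter_le_centralizerMod x), htype.index_secondCenter hclass hne,
    htype.secondCenter_inf_centralizer hclass hx] at h
  exact h.symm.trans (pow_succ' q 2).symm

theorem centralCommutators_mk_eq_center {x : G} (hx : x ∉ secondCenter G) :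
    centralCommutators (QuotientGroup.mk' (center G) x) ⊤ = center (G ⧸ center G) := by
  have hne : secondCenter G ≠ ⊤ := fun h => hx (h ▸ mem_top x)
  have hsurj := QuotientGroup.mk'_surjective (center G)
  have hmod : centralizerMod (QuotientGroup.mk' (center G) x) = ⊤ := by
    refine eq_top_iff.2 fun y _ => ?_
    obtain ⟨y, rfl⟩ := hsurj y
    rw [mem_centralizerMod, ← map_commutatorElement, ← mem_comap, comap_center_quotient_center]
    exact hclass x y
  have hcomm := card_centralCommutators_mul_index (QuotientGroup.mk' (center G) x) ⊤
  rw [hmod, top_inf_eq, top_inf_eq, index_top, mul_one, ← index_comap_of_surjective _ hsurj,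
    ← centralizerMod, htype.index_centralizerMod hclass hx] at hcomm
  have hcenter := card_mul_index (center (G ⧸ center G))
  rw [← index_comap_of_surjective _ hsurj, comap_center_quotient_center,
    htype.index_secondCenter hclass hne, ← index_eq_card, htype.index_center hclass hne,
    pow_succ' q 2, ← hcomm] at hcenter
  exact eq_of_le_of_card_ge (centralCommutators_le_center _ _)
    (Nat.eq_of_mul_eq_mul_right (hcomm ▸ zero_lt_one.trans htype.1) hcenter).le

theorem exists_commutatorElement_eq_mul_center {x u : G} (hx : x ∉ secondCenter G)
    (hu : u ∈ secondCenter G) : ∃ y, ∃ k ∈ center G, ⁅x, y⁆ = u * k := by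
  rw [← comap_center_quotient_center, mem_comap,
    ← htype.centralCommutators_mk_eq_center hclass hx] at hu
  obtain ⟨y, -, -, hy⟩ := mem_centralCommutators.1 hu
  obtain ⟨y, rfl⟩ := QuotientGroup.mk'_surjective _ y
  rw [← map_commutatorElement] at hy
  exact ⟨y, u⁻¹ * ⁅x, y⁆, QuotientGroup.eq.1 hy.symm, (mul_inv_cancel_left _ _).symm⟩

end SquareType

end IsConjugateType

section ClassTwo

variable {G : Type*} [Group G] (hcomm : ∀ x y : G, ⁅x, y⁆ ∈ center G)
  (hmul : ∀ x y : G, ¬Commute x y → ∀ v, ∃ a b, Commute x a ∧ Commute y b ∧ a * b = v)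
  (htrans : ∀ x a b : G, x ∉ center G → Commute x a → Commute x b → Commute a b)
include hcomm hmul htrans

theorem exists_commutatorElement_eq_of_commute {x a : G} (hx : x ∉ center G) (ha : Commute x a)
    (v : G) : ∃ w, ⁅a, v⁆ = ⁅x, w⁆ := by
  have hmul_left (x y z : G) : ⁅x * z, y⁆ = ⁅x, y⁆ * ⁅z, y⁆ :=
    commutatorElement_mul_left_of_mem_center x (hcomm z y)
  have hmul_right (x y z : G) : ⁅x, y * z⁆ = ⁅x, y⁆ * ⁅x, z⁆ :=
    commutatorElement_mul_right_of_mem_center y (hcomm x z)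
  obtain ⟨y, hxy⟩ : ∃ y, ¬Commute x y := by
    by_contra! h
    exact hx (mem_center_iff.2 fun y => (h y).symm)
  have hy : y ∉ center G := fun h => hxy (mem_center_iff.1 h x)
  obtain ⟨a', b, ha', hb, rfl⟩ := hmul x y hxy v
  have hxb : ¬Commute (x * b) y := by
    rwa [← commutatorElement_eq_one_iff_commute, hmul_left,
      commutatorElement_eq_one_iff_commute.2 hb.symm, mul_one,
      commutatorElement_eq_one_iff_commute]
  obtain ⟨s, t, hs, ht, hst⟩ := hmul (x * b) y hxb a
  have hbt : ⁅b, t⁻¹⁆ = 1 :=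
    commutatorElement_eq_one_iff_commute.2 (htrans y b t⁻¹ hy hb ht.inv_right)
  have hcancel : ⁅x, t⁻¹⁆ * ⁅b, a⁆ = 1 := by
    have h : ⁅x * b, a * t⁻¹⁆ = 1 := by
      rwa [← hst, mul_inv_cancel_right, commutatorElement_eq_one_iff_commute]
    rwa [hmul_left, hmul_right, hmul_right, commutatorElement_eq_one_iff_commute.2 ha, one_mul,
      hbt, mul_one] at h
  refine ⟨t⁻¹, ?_⟩
  rw [hmul_right, commutatorElement_eq_one_iff_commute.2 (htrans x a a' hx ha ha'), one_mul,
    eq_inv_of_mul_eq_one_left hcancel, commutatorElement_inv]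

theorem commutator_le_centralCommutators {x : G} (hx : x ∉ center G) :
    commutator G ≤ centralCommutators x ⊤ := by
  have hmem (w : G) : ⁅x, w⁆ ∈ centralCommutators x ⊤ :=
    commutatorElement_mem_centralCommutators (mem_centralizerMod.2 (hcomm x w))
  refine Subgroup.commutator_le.2 fun a _ v _ => ?_
  by_cases hax : Commute a x
  · obtain ⟨w, hw⟩ := exists_commutatorElement_eq_of_commute hcomm hmul htrans hx hax.symm v
    exact hw ▸ hmem w
  · obtain ⟨s, t, hs, ht, rfl⟩ := hmul a x hax v
    obtain ⟨w, hw⟩ := exists_commutatorElement_eq_of_commute hcomm hmul htrans hx ht a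
    rw [commutatorElement_mul_right_of_mem_center s (hcomm a t),
      commutatorElement_eq_one_iff_commute.2 hs, one_mul, ← commutatorElement_inv, hw]
    exact inv_mem (hmem w)

end ClassTwo

namespace IsConjugateType

section SecondCenter

variable {G : Type*} [Group G] [Finite G] {q : ℕ} (htype : IsConjugateType G (q ^ 2))
  (hclass : ∀ x y : G, ⁅x, y⁆ ∈ secondCenter G)
include htype hclass

theorem centralCommutators_centralizerMod {x c : G} (hx : x ∉ secondCenter G)
    (hc : c ∈ secondCenter G) (hc' : c ∉ center G) :
    centralCommutators c (centralizerMod x) = centralCommutators x ⊤ := by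
  obtain ⟨y, k, hk, hy⟩ := htype.exists_commutatorElement_eq_mul_center hclass hx hc
  have hxy : ⁅x, y⁆ ∉ center G := by rwa [hy, mul_mem_cancel_right hk]
  rw [← htype.centralCommutators_commutatorElement_left hclass hxy, hy,
    centralCommutators_mul_center hk]

theorem commutatorElement_mem_centralCommutators_iff (hne : secondCenter G ≠ ⊤) {c a b : G}
    (hc : c ∈ secondCenter G) (hc' : c ∉ center G) :
    ⁅a, b⁆ ∈ centralCommutators c ⊤ ↔ ⁅a, b⁆ ∈ center G := by
  refine ⟨fun h => centralCommutators_le_center c ⊤ h, fun h => ?_⟩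
  have hmem {a b : G} (ha : a ∉ secondCenter G) (h : ⁅a, b⁆ ∈ center G) :
      ⁅a, b⁆ ∈ centralCommutators c ⊤ :=
    centralCommutators_mono c le_top <|
      (htype.centralCommutators_centralizerMod hclass ha hc hc').ge <|
        commutatorElement_mem_centralCommutators (mem_centralizerMod.2 h)
  by_cases ha : a ∈ secondCenter G
  · by_cases hb : b ∈ secondCenter G
    · rw [htype.commutatorElement_secondCenter_eq_one hclass hne hb ha]
      exact one_mem _
    · rw [← commutatorElement_inv]
      exact inv_mem (hmem hb (commutatorElement_mem_center_comm.1 h))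
  · exact hmem ha h

/-- Commuting modulo `centralCommutators c ⊤` is the same as commuting modulo the centre, so the
quotient by it has class two and inherits the transitivity and factorization properties of
`centralizerMod`. -/
theorem exists_commutatorElement_mul_eq {c x g : G} (hc : c ∈ secondCenter G)
    (hc' : c ∉ center G) (hx : x ∉ secondCenter G) (hg : g ∈ commutator G) :
    ∃ y, ∃ w ∈ centralCommutators c ⊤, ⁅x, y⁆ * w = g := by
  have hne : secondCenter G ≠ ⊤ := fun h => hx (h ▸ mem_top x)
  set W := centralCommutators c ⊤
  have hW : W.Normal := ⟨fun w hw g => by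
    rwa [mem_center_iff.1 (centralCommutators_le_center c ⊤ hw) g, mul_inv_cancel_right]⟩
  let π := QuotientGroup.mk' W
  have hπ : Function.Surjective π := QuotientGroup.mk'_surjective W
  have hcommute {a b : G} : Commute (π a) (π b) ↔ ⁅a, b⁆ ∈ center G := by
    rw [← commutatorElement_eq_one_iff_commute, ← map_commutatorElement, QuotientGroup.mk'_apply,
      QuotientGroup.eq_one_iff,
      htype.commutatorElement_mem_centralCommutators_iff hclass hne hc hc']
  have hcenter {a : G} : π a ∈ center (G ⧸ W) ↔ a ∈ secondCenter G := by
    rw [mem_center_iff, hπ.forall, mem_secondCenter]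
    exact forall_congr' fun b => (Commute.symm_iff (a := π b)).trans hcommute
  have hle : commutator (G ⧸ W) ≤ centralCommutators (π x) ⊤ := by
    refine commutator_le_centralCommutators (hπ.forall₂.2 fun a b => ?_)
      (hπ.forall₂.2 fun a b hab => hπ.forall.2 fun v => ?_)
      (hπ.forall₃.2 fun a u v ha hu hv => ?_) (mt hcenter.1 hx)
    · rw [← map_commutatorElement, hcenter]
      exact hclass a b
    · obtain ⟨s, hs, t, ht, rfl⟩ := htype.exists_centralizerMod_mul_eq hclass (mt hcommute.2 hab) v
      exact ⟨π s, π t, hcommute.2 (mem_centralizerMod.1 hs), hcommute.2 (mem_centralizerMod.1 ht),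
        (map_mul π s t).symm⟩
    · exact hcommute.2 <| mem_centralizerMod.1 <| htype.centralizerMod_le_centralizerMod hclass
        (mt hcenter.2 ha) (mem_centralizerMod.2 (hcommute.1 hu))
        (mem_centralizerMod.2 (hcommute.1 hv))
  have hgπ : π g ∈ commutator (G ⧸ W) := by
    have h := mem_map_of_mem π hg
    rw [commutator_def, Subgroup.map_commutator] at h
    exact Subgroup.commutator_mono le_top le_top h
  obtain ⟨y, -, -, hy⟩ := mem_centralCommutators.1 (hle hgπ)
  obtain ⟨y, rfl⟩ := hπ y
  rw [← map_commutatorElement] at hy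
  exact ⟨y, ⁅x, y⁆⁻¹ * g, QuotientGroup.eq.1 hy, mul_inv_cancel_left _ _⟩

end SecondCenter

end IsConjugateType

section LeftFactors

variable {G : Type*} [Group G]

/-- The elements `x` for which `⁅x, y⁆ = g` has a solution `y`. -/
def leftFactors (g : G) : Set G := {x | ∃ y, ⁅x, y⁆ = g}

theorem mem_leftFactors {g x : G} : x ∈ leftFactors g ↔ ∃ y, ⁅x, y⁆ = g := Iff.rfl

theorem mem_leftFactors_iff_mem_centralCommutators {g x : G} (hg : g ∈ center G) :
    x ∈ leftFactors g ↔ g ∈ centralCommutators x ⊤ := by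
  rw [mem_leftFactors, mem_centralCommutators]
  constructor
  · rintro ⟨y, rfl⟩
    exact ⟨y, mem_top y, mem_centralizerMod.2 hg, rfl⟩
  · rintro ⟨y, -, -, hy⟩
    exact ⟨y, hy⟩

theorem notMem_center_of_mem_leftFactors {g x : G} (hg : g ≠ 1) (hx : x ∈ leftFactors g) :
    x ∉ center G := by
  obtain ⟨y, rfl⟩ := hx
  exact fun h => hg (commutatorElement_eq_one_of_mem_center_left h y)

theorem notMem_secondCenter_of_mem_leftFactors {g x : G} (hg : g ∉ center G)
    (hx : x ∈ leftFactors g) : x ∉ secondCenter G := by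
  obtain ⟨y, rfl⟩ := hx
  exact notMem_secondCenter_left hg

theorem mul_center_mem_leftFactors {g x k : G} (hk : k ∈ center G) (hx : x ∈ leftFactors g) :
    x * k ∈ leftFactors g := by
  obtain ⟨y, rfl⟩ := hx
  exact ⟨y, commutatorElement_mul_center_left hk x y⟩

theorem inv_mul_mem_centralizerMod {x y z : G} :
    y⁻¹ * z ∈ centralizerMod x ↔ ⁅x, y⁆⁻¹ * ⁅x, z⁆ ∈ center G := by
  rw [centralizerMod, mem_comap, map_mul, map_inv,
    ← commutatorElement_eq_iff_inv_mul_mem_centralizer, ← map_commutatorElement,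
    ← map_commutatorElement]
  exact QuotientGroup.eq

theorem ncard_eq_index_mul_card {K H : Subgroup G} (hK : K ≤ H) {T : Set G}
    (hexists : ∀ x, ∃ h ∈ H, x * h ∈ T) (hmem : ∀ t ∈ T, ∀ h ∈ H, t * h ∈ T ↔ h ∈ K) :
    T.ncard = H.index * Nat.card K := by
  have hrep (c : G ⧸ H) : ∃ t ∈ T, (t : G ⧸ H) = c := by
    induction c using QuotientGroup.induction_on with | H x =>
    obtain ⟨h, hh, hx⟩ := hexists x
    exact ⟨x * h, hx, QuotientGroup.mk_mul_of_mem x hh⟩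
  choose t ht hmk using hrep
  let f : (G ⧸ H) × K → T := fun p => ⟨t p.1 * p.2, (hmem _ (ht p.1) _ (hK p.2.2)).2 p.2.2⟩
  have hf : Function.Bijective f := by
    refine ⟨fun p p' hpp => ?_, fun s => ?_⟩
    · have heq : t p.1 * (p.2 : G) = t p'.1 * p'.2 := congrArg Subtype.val hpp
      have hc : p.1 = p'.1 := by
        rw [← hmk p.1, ← hmk p'.1, ← QuotientGroup.mk_mul_of_mem (t p.1) (hK p.2.2), heq,
          QuotientGroup.mk_mul_of_mem _ (hK p'.2.2)]
      rw [hc] at heq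
      exact Prod.ext hc (Subtype.ext (mul_left_cancel heq))
    · have hh : (t (s : G))⁻¹ * s ∈ H := QuotientGroup.eq.1 (hmk s)
      have hk : (t (s : G))⁻¹ * s ∈ K :=
        (hmem _ (ht s) _ hh).1 (by rw [mul_inv_cancel_left]; exact s.2)
      exact ⟨(s, ⟨_, hk⟩), Subtype.ext (mul_inv_cancel_left _ _)⟩
  rw [← Nat.card_coe_set_eq, ← Nat.card_congr (Equiv.ofBijective f hf), Nat.card_prod, index]

end LeftFactors

namespace IsConjugateType

section LeftFactors

variable {G : Type*} [Group G] [Finite G] {q : ℕ} (htype : IsConjugateType G (q ^ 2))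
  (hclass : ∀ x y : G, ⁅x, y⁆ ∈ secondCenter G)
include htype hclass

theorem exists_commutatorElement_eq_of_mem_center (hne : secondCenter G ≠ ⊤) {c g : G}
    (hc : c ∈ secondCenter G) (hc' : c ∉ center G) (hg : g ∈ commutator G) (hgc : g ∈ center G) :
    ∃ t, ⁅c, t⁆ = g := by
  obtain ⟨x, v, hxv⟩ := exists_commutatorElement_notMem_center_of_ne_top hne
  obtain ⟨y, w, hw, rfl⟩ := htype.exists_commutatorElement_mul_eq hclass hc hc'
    (notMem_secondCenter_left hxv) hg
  have hxy : ⁅x, y⁆ ∈ center G :=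
    (mul_mem_cancel_right (centralCommutators_le_center c ⊤ hw)).1 hgc
  obtain ⟨t, -, -, ht⟩ := mem_centralCommutators.1 <| mul_mem
    ((htype.commutatorElement_mem_centralCommutators_iff hclass hne hc hc').2 hxy) hw
  exact ⟨t, ht⟩

theorem leftFactors_commutatorElement {c t : G} (hc : c ∈ secondCenter G) (hc' : c ∉ center G)
    (ht : t ∉ secondCenter G) :
    leftFactors ⁅c, t⁆ = (centralizerMod t : Set G) \ (center G : Set G) := by
  have hne : secondCenter G ≠ ⊤ := fun h => ht (h ▸ mem_top t)
  have hcenter : ⁅c, t⁆ ∈ center G := mem_secondCenter.1 hc t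
  have hker := htype.centralizer_eq_secondCenter hclass hne hc hc'
  have hone : ⁅c, t⁆ ≠ 1 := by
    rwa [Ne, ← mem_centralizer_singleton_iff_commutatorElement, hker]
  ext x
  by_cases hxc : x ∈ center G
  · exact iff_of_false (fun h => notMem_center_of_mem_leftFactors hone h hxc) fun h => h.2 hxc
  rw [Set.mem_sdiff, SetLike.mem_coe, SetLike.mem_coe, and_iff_left hxc,
    mem_leftFactors_iff_mem_centralCommutators hcenter]
  by_cases hx : x ∈ secondCenter G
  · exact iff_of_true
      ((htype.commutatorElement_mem_centralCommutators_iff hclass hne hx hxc).2 hcenter)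
      (secondCenter_le_centralizerMod t hx)
  rw [← htype.centralCommutators_centralizerMod hclass hx hc hc', mem_centralCommutators,
    mem_centralizerMod_comm]
  refine ⟨?_, fun h => ⟨t, h, mem_centralizerMod.2 hcenter, rfl⟩⟩
  rintro ⟨s, hs, -, hst⟩
  rw [commutatorElement_eq_iff_inv_mul_mem_centralizer, hker] at hst
  exact (mul_mem_cancel_left (inv_mem hs)).1 (secondCenter_le_centralizerMod x hst)

theorem exists_commutatorElement_mul_mul_eq {x g : G} (hx : x ∉ secondCenter G)
    (hg : g ∈ commutator G) (hgc : g ∉ center G) :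
    ∃ y, ⁅x, y⁆ ∉ center G ∧
      ∃ a ∈ centralCommutators x ⊤, ∃ b ∈ centralCommutators y ⊤, ⁅x, y⁆ * b * a = g := by
  obtain ⟨v, hxv⟩ := exists_commutatorElement_notMem_center hx
  obtain ⟨y, w, hw, rfl⟩ := htype.exists_commutatorElement_mul_eq hclass (hclass x v) hxv hx hg
  have hwc := centralCommutators_le_center _ _ hw
  have hxy : ⁅x, y⁆ ∉ center G := fun h => hgc (mul_mem h hwc)
  obtain ⟨s, -, -, rfl⟩ := mem_centralCommutators.1 hw
  obtain ⟨s, -, hs, hw⟩ := mem_centralCommutators.1 <|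
    (htype.commutatorElement_mem_centralCommutators_iff hclass (fun h => hx (h ▸ mem_top x))
      (hclass x y) hxy).2 hwc
  obtain ⟨a, ha, b, hb, rfl⟩ := htype.exists_centralizerMod_mul_eq hclass hxy s
  have hmem (z : G) : z ∈ centralizerMod ⁅x, y⁆ := mem_centralizerMod.2
    (mem_secondCenter.1 (hclass x y) z)
  refine ⟨y, hxy, ⁅⁅x, y⁆, a⁆, ?_, ⁅⁅x, y⁆, b⁆, ?_, ?_⟩
  · rw [← htype.centralCommutators_commutatorElement_left hclass hxy]
    exact mem_centralCommutators.2 ⟨a, ha, hmem a, rfl⟩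
  · rw [← htype.centralCommutators_commutatorElement_right hclass hxy]
    exact mem_centralCommutators.2 ⟨b, hb, hmem b, rfl⟩
  · rw [← hw, commutatorElement_mul_right_of_mem_center a (mem_centralizerMod.1 (hmem b)),
      mul_assoc, mem_center_iff.1 (mem_centralizerMod.1 (hmem b))]

theorem exists_mul_mem_leftFactors {x g : G} (hx : x ∉ secondCenter G) (hg : g ∈ commutator G)
    (hgc : g ∉ center G) : ∃ z ∈ secondCenter G, x * z ∈ leftFactors g := by
  obtain ⟨y, hxy, a, ha, b, hb, rfl⟩ :=
    htype.exists_commutatorElement_mul_mul_eq hclass hx hg hgc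
  rw [htype.centralCommutators_top_eq_secondCenter hclass (notMem_secondCenter_right hxy),
    ← inv_mem_iff] at hb
  obtain ⟨z, hz, -, hyz⟩ := mem_centralCommutators.1 hb
  rw [← htype.centralCommutators_mul_secondCenter hclass hx hz] at ha
  obtain ⟨t, -, ht, rfl⟩ := mem_centralCommutators.1 ha
  refine ⟨z, hz, y * t, ?_⟩
  rw [commutatorElement_mul_right_of_mem_center y (mem_centralizerMod.1 ht),
    commutatorElement_mul_secondCenter_left hz, ← commutatorElement_inv y z, hyz, inv_inv]

theorem mem_center_of_mul_mem_leftFactors {x z g : G} (hgc : g ∉ center G)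
    (hx : x ∈ leftFactors g) (hz : z ∈ secondCenter G) (hxz : x * z ∈ leftFactors g) :
    z ∈ center G := by
  obtain ⟨y, rfl⟩ := hx
  obtain ⟨v, hv⟩ := hxz
  have hx := notMem_secondCenter_left hgc
  have hy := notMem_secondCenter_right hgc
  obtain ⟨k, rfl⟩ : ∃ k, v = y * k := ⟨y⁻¹ * v, (mul_inv_cancel_left _ _).symm⟩
  have hkx : k ∈ centralizerMod x := by
    rw [← inv_mul_cancel_left y k, inv_mul_mem_centralizerMod, ← hv,
      commutatorElement_mul_secondCenter_left hz, mul_inv_rev, inv_mul_cancel_right]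
    exact inv_mem (mem_secondCenter.1 hz _)
  have hkxz : k ∈ centralizerMod (x * z) := mem_centralizerMod_comm.1
    (mul_mem (mem_centralizerMod_comm.1 hkx) (secondCenter_le_centralizerMod k hz))
  rw [commutatorElement_mul_right_of_mem_center y (mem_centralizerMod.1 hkxz),
    commutatorElement_mul_secondCenter_left hz, mul_assoc, mul_eq_left] at hv
  have hzy : ⁅z, y⁆ ∈ centralCommutators x ⊤ := by
    rw [eq_inv_of_mul_eq_one_left hv, inv_mem_iff,
      ← htype.centralCommutators_mul_secondCenter hclass hx hz]
    exact commutatorElement_mem_centralCommutators hkxz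
  have hzy' : ⁅y, z⁆ ∈ centralCommutators y ⊤ :=
    commutatorElement_mem_centralCommutators (secondCenter_le_centralizerMod y hz)
  have hone : ⁅y, z⁆ = 1 := disjoint_def.1 (htype.disjoint_centralCommutators hclass hgc)
    (commutatorElement_inv z y ▸ inv_mem hzy) hzy'
  rw [← htype.secondCenter_inf_centralizer hclass hy]
  exact ⟨hz, mem_centralizer_singleton_iff_commutatorElement.2 hone⟩

theorem ncard_leftFactors_union_center_of_notMem_center {g : G} (hg : g ∈ commutator G)
    (hgc : g ∉ center G) :
    (leftFactors g ∪ center G).ncard = (secondCenter G).index * Nat.card (center G) := by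
  refine ncard_eq_index_mul_card center_le_secondCenter (fun x => ?_) fun t ht h hh => ?_
  · by_cases hx : x ∈ secondCenter G
    · exact ⟨x⁻¹, inv_mem hx, Or.inr (by rw [mul_inv_cancel]; exact one_mem _)⟩
    · obtain ⟨z, hz, hxz⟩ := htype.exists_mul_mem_leftFactors hclass hx hg hgc
      exact ⟨z, hz, Or.inl hxz⟩
  have hnot {s : G} (hs : s ∈ leftFactors g) := notMem_secondCenter_of_mem_leftFactors hgc hs
  obtain ht | ht := ht
  · refine ⟨fun hth => ?_, fun hk => Or.inl (mul_center_mem_leftFactors hk ht)⟩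
    obtain hth | hth := hth
    · exact htype.mem_center_of_mul_mem_leftFactors hclass hgc ht hh hth
    · exact absurd ((mul_mem_cancel_right hh).1 (center_le_secondCenter hth)) (hnot ht)
  · refine ⟨fun hth => ?_, fun hk => Or.inr (mul_mem ht hk)⟩
    obtain hth | hth := hth
    · exact absurd (mul_mem (center_le_secondCenter ht) hh) (hnot hth)
    · exact (mul_mem_cancel_left ht).1 hth

theorem exists_leftFactors_union_center_eq_centralizerMod (hne : secondCenter G ≠ ⊤) {g : G}
    (hg : g ∈ commutator G) (hg1 : g ≠ 1) (hgc : g ∈ center G) :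
    ∃ t ∉ secondCenter G, leftFactors g ∪ center G = centralizerMod t := by
  obtain ⟨x, y, hxy⟩ := exists_commutatorElement_notMem_center_of_ne_top hne
  obtain ⟨t, rfl⟩ := htype.exists_commutatorElement_eq_of_mem_center hclass hne (hclass x y) hxy
    hg hgc
  have ht : t ∉ secondCenter G := fun h =>
    hg1 (htype.commutatorElement_secondCenter_eq_one hclass hne h (hclass x y))
  refine ⟨t, ht, ?_⟩
  rw [htype.leftFactors_commutatorElement hclass (hclass x y) hxy ht]
  exact Set.sdiff_union_of_subset
    (center_le_secondCenter.trans (secondCenter_le_centralizerMod t))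

theorem card_centralizerMod {x : G} (hx : x ∉ secondCenter G) :
    Nat.card (centralizerMod x) = q ^ 2 * Nat.card (center G) := by
  have hpos : 0 < (centralizerMod x).index := Nat.pos_of_ne_zero index_ne_zero_of_finite
  refine Nat.eq_of_mul_eq_mul_right hpos ?_
  rw [card_mul_index, ← card_mul_index (center G),
    htype.index_center hclass fun h => hx (h ▸ mem_top x), htype.index_centralizerMod hclass hx]
  ring

theorem ncard_leftFactors_union_center (hne : secondCenter G ≠ ⊤) {g : G}
    (hg : g ∈ commutator G) (hg1 : g ≠ 1) :
    (leftFactors g ∪ center G).ncard = q ^ 2 * Nat.card (center G) := by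
  by_cases hgc : g ∈ center G
  · obtain ⟨t, ht, heq⟩ :=
      htype.exists_leftFactors_union_center_eq_centralizerMod hclass hne hg hg1 hgc
    rw [heq, ← htype.card_centralizerMod hclass ht]
    exact (Nat.card_coe_set_eq _).symm
  · rw [htype.ncard_leftFactors_union_center_of_notMem_center hclass hg hgc,
      htype.index_secondCenter hclass hne]

end LeftFactors

end IsConjugateType

section Counting

variable {G : Type*} [Group G]

theorem card_commutatorElement_eq {x g : G} (hx : x ∈ leftFactors g) :
    Nat.card {y // ⁅x, y⁆ = g} = Nat.card (centralizer {x}) := by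
  obtain ⟨y, rfl⟩ := hx
  refine Nat.card_congr ((Equiv.mulLeft y⁻¹).subtypeEquiv fun z => ?_)
  rw [eq_comm, commutatorElement_eq_iff_inv_mul_mem_centralizer]
  rfl

theorem card_commFiber [Fintype G] (g : G) :
    Nat.card (commFiber g) = ∑ x : G, Nat.card {y // ⁅x, y⁆ = g} := by
  have hinv (p : G × G) :
      p ∈ commFiber g ↔ ⁅(Equiv.inv (G × G) p).1, (Equiv.inv (G × G) p).2⁆ = g := by
    rw [commFiber, Set.mem_ofPred_eq, groupComm_eq_commutatorElement_inv]
    rfl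
  rw [← Nat.card_sigma]
  exact Nat.card_congr (((Equiv.inv (G × G)).subtypeEquiv hinv).trans
    (Equiv.subtypeProdEquivSigmaSubtype fun x y => ⁅x, y⁆ = g))

namespace IsConjugateType

section CommFiber

variable {m : ℕ} (htype : IsConjugateType G m)
include htype

theorem card_commutatorElement_eq_mul {x g : G} (hx : x ∈ leftFactors g) (hxc : x ∉ center G) :
    Nat.card {y // ⁅x, y⁆ = g} * m = Nat.card G := by
  rw [card_commutatorElement_eq hx, ← htype.index_centralizer hxc, card_mul_index]

variable [Finite G]

theorem card_commFiber_mul {g : G} (hg : g ≠ 1) :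
    Nat.card (commFiber g) * m = (leftFactors g).ncard * Nat.card G := by
  classical
  have := Fintype.ofFinite G
  have hterm (x : G) : Nat.card {y // ⁅x, y⁆ = g} * m =
      if x ∈ leftFactors g then Nat.card G else 0 := by
    split_ifs with hx
    · exact htype.card_commutatorElement_eq_mul hx (notMem_center_of_mem_leftFactors hg hx)
    · have : IsEmpty {y // ⁅x, y⁆ = g} := ⟨fun y => hx ⟨y, y.2⟩⟩
      rw [Nat.card_of_isEmpty, zero_mul]
  rw [card_commFiber, Finset.sum_mul, Finset.sum_congr rfl fun x _ => hterm x,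
    ← Finset.sum_filter, Finset.sum_const, smul_eq_mul, Set.ncard_eq_toFinset_card',
    Set.filter_mem_univ_eq_toFinset]

theorem card_commFiber_one_mul :
    Nat.card (commFiber (1 : G)) * m =
      Nat.card (center G) * (Nat.card G * m) + (center G : Set G)ᶜ.ncard * Nat.card G := by
  classical
  have := Fintype.ofFinite G
  have hterm (x : G) : Nat.card {y // ⁅x, y⁆ = (1 : G)} * m =
      if x ∈ (center G : Set G) then Nat.card G * m else Nat.card G := by
    split_ifs with hx
    · rw [Nat.card_congr (Equiv.subtypeUnivEquiv
        (commutatorElement_eq_one_of_mem_center_left hx))]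
    · exact htype.card_commutatorElement_eq_mul ⟨1, commutatorElement_one_right x⟩ hx
  rw [card_commFiber, Finset.sum_mul, Finset.sum_congr rfl fun x _ => hterm x, Finset.sum_ite,
    Finset.sum_const, Finset.sum_const, smul_eq_mul, smul_eq_mul, ← Set.ncard_coe_finset,
    ← Set.ncard_coe_finset, Finset.coe_filter_univ, Finset.coe_filter_univ]
  rfl

end CommFiber

section CommPr

theorem cast_ne_zero {q : ℕ} (htype : IsConjugateType G (q ^ 2)) : (q : ℚ) ≠ 0 := by
  refine Nat.cast_ne_zero.2 ?_
  rintro rfl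
  exact absurd htype.1 (by norm_num)

variable [Finite G] {q : ℕ} (htype : IsConjugateType G (q ^ 2))
  (hclass : ∀ x y : G, ⁅x, y⁆ ∈ secondCenter G)
include htype hclass

theorem card_eq_pow_mul_card_center (hne : secondCenter G ≠ ⊤) :
    Nat.card G = q ^ 3 * Nat.card (center G) := by
  rw [← htype.index_center hclass hne, index_mul_card]

theorem commPr_eq_of_ne_one (hne : secondCenter G ≠ ⊤) {g : G} (hg : g ∈ commutator G)
    (hg1 : g ≠ 1) : commPr g = ((q : ℚ) ^ 2 - 1) / (q : ℚ) ^ 5 := by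
  have hq := htype.cast_ne_zero
  have hz : (Nat.card (center G) : ℚ) ≠ 0 := Nat.cast_ne_zero.2 Nat.card_pos.ne'
  have hleft : ((leftFactors g).ncard : ℚ) + Nat.card (center G) = q ^ 2 * Nat.card (center G) := by
    have h := htype.ncard_leftFactors_union_center hclass hne hg hg1
    rw [Set.ncard_union_eq (Set.disjoint_left.2 fun _ => notMem_center_of_mem_leftFactors hg1),
      ← Nat.card_coe_set_eq (center G : Set G)] at h
    exact_mod_cast h
  have hfiber : (Nat.card (commFiber g) : ℚ) * q ^ 2 = (leftFactors g).ncard * Nat.card G :=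
    mod_cast htype.card_commFiber_mul hg1
  have hcard : (Nat.card G : ℚ) = q ^ 3 * Nat.card (center G) :=
    mod_cast htype.card_eq_pow_mul_card_center hclass hne
  rw [hcard] at hfiber
  rw [commPr, hcard, div_eq_div_iff (by positivity) (by positivity)]
  linear_combination q ^ 3 * hfiber + q ^ 6 * Nat.card (center G) * hleft

theorem commPr_one (hne : secondCenter G ≠ ⊤) :
    commPr (1 : G) = ((q : ℚ) ^ 3 + (q : ℚ) ^ 2 - 1) / (q : ℚ) ^ 5 := by
  have hq := htype.cast_ne_zero
  have hz : (Nat.card (center G) : ℚ) ≠ 0 := Nat.cast_ne_zero.2 Nat.card_pos.ne'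
  have hcard : (Nat.card G : ℚ) = q ^ 3 * Nat.card (center G) :=
    mod_cast htype.card_eq_pow_mul_card_center hclass hne
  have hcompl : (Nat.card (center G) : ℚ) + (center G : Set G)ᶜ.ncard = Nat.card G :=
    mod_cast Set.ncard_add_ncard_compl (center G : Set G)
  have hfiber : (Nat.card (commFiber (1 : G)) : ℚ) * q ^ 2 =
      Nat.card (center G) * (Nat.card G * q ^ 2) + (center G : Set G)ᶜ.ncard * Nat.card G :=
    mod_cast htype.card_commFiber_one_mul
  rw [hcard] at hfiber hcompl
  rw [commPr, hcard, div_eq_div_iff (by positivity) (by positivity)]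
  linear_combination q ^ 3 * hfiber + q ^ 6 * Nat.card (center G) * hcompl

theorem ncard_commPrSet (hne : secondCenter G ≠ ⊤) : (commPrSet G).ncard = 1 := by
  refine Set.ncard_eq_one.2 ⟨((q : ℚ) ^ 2 - 1) / (q : ℚ) ^ 5, Set.Subset.antisymm ?_ ?_⟩
  · rintro _ ⟨_, ⟨x, y, rfl⟩, hg1, rfl⟩
    exact htype.commPr_eq_of_ne_one hclass hne (groupComm_mem_commutator x y) hg1
  · rintro _ rfl
    obtain ⟨x, y, hxy⟩ := exists_commutatorElement_notMem_center_of_ne_top hne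
    have hg : groupComm x⁻¹ y⁻¹ = ⁅x, y⁆ := by
      rw [groupComm_eq_commutatorElement_inv, inv_inv, inv_inv]
    have hg1 : groupComm x⁻¹ y⁻¹ ≠ 1 := fun h => hxy (hg ▸ h ▸ one_mem _)
    exact ⟨_, ⟨x⁻¹, y⁻¹, rfl⟩, hg1,
      htype.commPr_eq_of_ne_one hclass hne (groupComm_mem_commutator _ _) hg1⟩

end CommPr

end IsConjugateType

end Counting

section NilpotencyClass

variable {G : Type*} [Group G]

theorem isNilpotent_of_nilpotencyClass_ne_zero (h : Group.nilpotencyClass G ≠ 0) :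
    Group.IsNilpotent G :=
  not_imp_comm.1 Group.nilpotencyClass_of_not_nilpotent h

variable [Group.IsNilpotent G]

theorem commutatorElement_mem_secondCenter (h : Group.nilpotencyClass G ≤ 3) (x y : G) :
    ⁅x, y⁆ ∈ secondCenter G :=
  Subgroup.mem_upperCentralSeries_succ_iff.1
    (Subgroup.upperCentralSeries_eq_top_iff_nilpotencyClass_le.2 h ▸ mem_top x) y

theorem secondCenter_ne_top (h : 2 < Group.nilpotencyClass G) : secondCenter G ≠ ⊤ :=
  fun htop => h.not_ge (Subgroup.upperCentralSeries_eq_top_iff_nilpotencyClass_le.1 htop)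

end NilpotencyClass

theorem theorem1p2_general {G : Type*} [Group G] [Finite G] {m : ℕ}
    (hclass : Group.nilpotencyClass G = 3) (htype : IsConjugateType G m) :
    ∃ q : ℕ, m = q ^ 2 ∧
      commPr (1 : G) = ((q : ℚ) ^ 3 + (q : ℚ) ^ 2 - 1) / (q : ℚ) ^ 5 ∧
      (∀ g ∈ commutator G, g ≠ 1 → commPr g = ((q : ℚ) ^ 2 - 1) / (q : ℚ) ^ 5) ∧
      (commPrSet G).ncard = 1 := by
  have : Group.IsNilpotent G := isNilpotent_of_nilpotencyClass_ne_zero (by rw [hclass]; norm_num)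
  have hcomm := commutatorElement_mem_secondCenter hclass.le
  have hne : secondCenter G ≠ ⊤ := secondCenter_ne_top (by rw [hclass]; norm_num)
  obtain ⟨x, y, hxy⟩ := exists_commutatorElement_notMem_center_of_ne_top hne
  obtain ⟨q, rfl⟩ : ∃ q, m = q ^ 2 :=
    ⟨_, (htype.index_centralizerMod_sq hcomm (notMem_secondCenter_left hxy)).symm⟩
  exact ⟨q, rfl, htype.commPr_one hcomm hne,
    fun g hg hg1 => htype.commPr_eq_of_ne_one hcomm hne hg hg1, htype.ncard_commPrSet hcomm hne⟩

theorem theorem1p2 {G : Type*} [Group G] [Finite G] (p n : ℕ) (hp : p.Prime)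
    (hG : IsPGroup p G) (hclass : Group.nilpotencyClass G = 3)
    (htype : IsConjugateType G (p ^ (2 * n))) :
    commPr (1 : G) = ((p : ℚ) ^ (3 * n) + (p : ℚ) ^ (2 * n) - 1) / (p : ℚ) ^ (5 * n) ∧
    (∀ g ∈ commutator G, g ≠ 1 →
      commPr g = ((p : ℚ) ^ (2 * n) - 1) / (p : ℚ) ^ (5 * n)) ∧
    (commPrSet G).ncard = 1 := by
  obtain ⟨q, hq, h⟩ := theorem1p2_general hclass htype
  rw [mul_comm, pow_mul] at hq
  obtain rfl : p ^ n = q := Nat.pow_left_injective two_ne_zero hq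
  simpa only [Nat.cast_pow, ← pow_mul, mul_comm n] using h
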